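/- There is an absolute constant $C>0$ such that the following holds for all integers $n\ge 3$ and $m\ge 0$. Let $m$ tasks be scheduled on $n$ machines, where the time $t_{ij}\ge 0$ that machine $i$ needs for task $j$ is random, all $t_{ij}$ ($1\le i\le n$, $1\le j\le m$) are independent, and for each task $j$ the times $t_{1j},\dots,t_{nj}$ all follow the same distribution $\mathcal D_j$ on $[0,\infty)$ (the distributions $\mathcal D_1,\dots,\mathcal D_m$ are arbitrary and may differ). The VCG mechanism allocates each task $j$ to a machine $i$ with $t_{ij}=\min_{i'}t_{i'j}$, chosen uniformly at random among all such machines, independently for different tasks and independently of the processing times given the set of fastest machines of each task. Let $\mathrm{VCG}(t)$ be the makespan of this allocation, that is, the maximum over the machines of the total processing time of the tasks allocated to it, and let $\mathrm{OPT}(t)$ be the minimum makespan over all allocations of the $m$ tasks to the $n$ machines. Then $$\mathbb E[\mathrm{VCG}(t)]\;\le\; C\,\frac{\ln n}{\ln\ln n}\;\mathbb E[\mathrm{OPT}(t)],$$ where the expectations are over the processing times and the tie-breaking and take values in $[0,\infty]$ (so the left side is finite whenever $\mathbb E[\mathrm{OPT}(t)]$ is). -/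

import Mathlib

open scoped NNReal ENNReal

namespace Scheduling

noncomputable section

/-- A matrix of processing times: `t i j` is the time that machine `i` needs for task `j`. -/
abbrev Times (n m : ℕ) : Type := Fin n → Fin m → ℝ≥0

/-- An allocation assigns every task to exactly one machine. -/
abbrev Allocation (n m : ℕ) : Type := Fin m → Fin n

/-- The workload of machine `i` under the allocation `σ`. -/
def workload {n m : ℕ} (t : Times n m) (σ : Allocation n m) (i : Fin n) : ℝ≥0 :=
  ∑ j : Fin m, if σ j = i then t i j else 0

/-- The makespan of an allocation: the maximum workload of a machine. -/
def makespan {n m : ℕ} (t : Times n m) (σ : Allocation n m) : ℝ≥0 :=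
  Finset.univ.sup (workload t σ)

/-- The optimal makespan of `t`: the minimum makespan over all (finitely many) allocations. -/
def opt {n m : ℕ} (t : Times n m) : ℝ≥0 :=
  ⨅ σ : Allocation n m, makespan t σ

/-- The machines whose processing time for task `j` is smallest. -/
def fastest {n m : ℕ} (t : Times n m) (j : Fin m) : Finset (Fin n) :=
  Finset.univ.filter fun i => ∀ i' : Fin n, t i j ≤ t i' j

/-- The probability that VCG outputs the allocation `σ` on input `t`: each task goes,
independently of the other tasks, to a uniformly random one of its fastest machines. -/
def vcgProb {n m : ℕ} (t : Times n m) (σ : Allocation n m) : ℝ≥0 :=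
  ∏ j : Fin m, if σ j ∈ fastest t j then ((fastest t j).card : ℝ≥0)⁻¹ else 0

/-- The expected makespan of VCG on input `t`, over the random tie-breaking. -/
def vcg {n m : ℕ} (t : Times n m) : ℝ≥0 :=
  ∑ σ : Allocation n m, vcgProb t σ * makespan t σ

end

end Scheduling

open MeasureTheory ProbabilityTheory

namespace Scheduling

/-! Cyclically relabelling the machines, separately for each task, preserves the joint law of the
times, so the VCG makespan may be averaged over all `n ^ m` relabellings on each fixed input. This
average throws the minimal times as balls uniformly into `n` bins (`sum_vcg_shift`). Each ball
weighs at most `opt t` and the total is at most `n * opt t`, so exponential moments bound the mean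
maximum load (`sum_maxLoad_le`). -/

/-- Convexity of the exponential on `[0, 1]`, rescaled. -/
lemma exp_mul_le_one_add {s w : ℝ} (h0 : 0 ≤ w) (h1 : w ≤ 1) :
    Real.exp (s * w) ≤ 1 + w * (Real.exp s - 1) := by
  have h := convexOn_exp.2 (Set.mem_univ 0) (Set.mem_univ s) (sub_nonneg.2 h1) h0 (by ring)
  simp only [smul_eq_mul, mul_zero, zero_add, Real.exp_zero, mul_one] at h
  rw [mul_comm s w]
  linarith

/-- The exponential moment of the load of one bin when balls of weights `w j ≤ 1` with total
weight at most `n` are thrown into `n` bins uniformly at random. -/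
lemma sum_exp_load_le {n m : ℕ} (hn : 0 < n) {s : ℝ} (hs : 0 ≤ s) (w : Fin m → ℝ)
    (h0 : ∀ j, 0 ≤ w j) (h1 : ∀ j, w j ≤ 1) (hsum : ∑ j, w j ≤ n) (i : Fin n) :
    ∑ ρ : Allocation n m, Real.exp (s * ∑ j, if ρ j = i then w j else 0) ≤
      (n : ℝ) ^ m * Real.exp (Real.exp s - 1) := by
  have hn' : (0 : ℝ) < n := by exact_mod_cast hn
  have hs' : 0 ≤ Real.exp s - 1 := by linarith [Real.one_le_exp hs]
  have hfac : ∑ ρ : Allocation n m, Real.exp (s * ∑ j, if ρ j = i then w j else 0) =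
      ∏ j, ∑ k : Fin n, Real.exp (s * if k = i then w j else 0) := by
    rw [Finset.prod_univ_sum, Fintype.piFinset_univ]
    exact Finset.sum_congr rfl fun ρ _ => by rw [Finset.mul_sum, Real.exp_sum]
  have hcol : ∀ j, ∑ k : Fin n, Real.exp (s * if k = i then w j else 0) ≤
      n * Real.exp (w j * (Real.exp s - 1) / n) := by
    intro j
    have hterm : ∀ k : Fin n, Real.exp (s * if k = i then w j else 0) ≤
        1 + if k = i then w j * (Real.exp s - 1) else 0 := by
      intro k
      split_ifs
      · exact exp_mul_le_one_add (h0 j) (h1 j)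
      · simp
    calc _ ≤ ∑ k : Fin n, (1 + if k = i then w j * (Real.exp s - 1) else 0) :=
          Finset.sum_le_sum fun k _ => hterm k
      _ = n * (w j * (Real.exp s - 1) / n + 1) := by
          rw [Finset.sum_add_distrib]
          simp
          field_simp
          ring
      _ ≤ _ := by gcongr; exact Real.add_one_le_exp _
  rw [hfac]
  calc _ ≤ ∏ j : Fin m, (n * Real.exp (w j * (Real.exp s - 1) / n)) :=
        Finset.prod_le_prod (fun j _ => by positivity) fun j _ => hcol j
    _ = (n : ℝ) ^ m * Real.exp ((∑ j, w j) / n * (Real.exp s - 1)) := by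
        rw [Finset.prod_mul_distrib, ← Real.exp_sum, Finset.sum_div, Finset.sum_mul]
        simp [div_mul_eq_mul_div]
    _ ≤ _ := by
        gcongr
        exact mul_le_of_le_one_left hs' ((div_le_one hn').2 hsum)

/-- The maximum load of weighted balls allocated to bins by `ρ`. -/
noncomputable def maxLoad {n m : ℕ} (w : Fin m → ℝ≥0) (ρ : Allocation n m) : ℝ≥0 :=
  Finset.univ.sup fun i : Fin n => ∑ j, if ρ j = i then w j else 0

lemma makespan_eq_maxLoad {n m : ℕ} (t : Times n m) (σ : Allocation n m) :
    makespan t σ = maxLoad (fun j => t (σ j) j) σ := by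
  unfold makespan maxLoad workload
  congr! 4 with i j _ h
  rw [← h]

lemma exists_maxLoad_eq {n m : ℕ} (hn : 0 < n) (w : Fin m → ℝ≥0) (ρ : Allocation n m) :
    ∃ i : Fin n, maxLoad w ρ = ∑ j, if ρ j = i then w j else 0 := by
  have : Nonempty (Fin n) := ⟨⟨0, hn⟩⟩
  obtain ⟨i, -, hi⟩ := Finset.exists_mem_eq_sup (Finset.univ : Finset (Fin n))
    Finset.univ_nonempty fun i : Fin n => ∑ j, if ρ j = i then w j else 0
  exact ⟨i, hi⟩

/-- The expected maximum load of weighted balls in `n` bins, bounded by the exponential moment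
method. -/
lemma sum_maxLoad_le {n m : ℕ} (hn : 3 ≤ n) (w : Fin m → ℝ≥0) (M : ℝ≥0)
    (hw : ∀ j, w j ≤ M) (hsum : ∑ j, w j ≤ n * M) :
    ∑ ρ : Allocation n m, (maxLoad w ρ : ℝ) ≤
      (n : ℝ) ^ m * (2 * (Real.log n / Real.log (Real.log n)) * M) := by
  have hn0 : (0 : ℝ) < n := by positivity
  have hlog : 1 < Real.log n := by
    rw [Real.lt_log_iff_exp_lt hn0]
    exact Real.exp_one_lt_three.trans_le (by exact_mod_cast hn)
  -- With `exp s = log n`, both terms of `a` below are at most `log n`, and the final bound `a / s`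
  -- has the desired order.
  set s := Real.log (Real.log n)
  have hs : 0 < s := Real.log_pos hlog
  have hes : Real.exp s = Real.log n := Real.exp_log (by linarith)
  rcases eq_or_ne M 0 with rfl | hM
  · have hw0 : ∀ j, w j = 0 := fun j => le_antisymm (hw j) bot_le
    have hload : ∀ ρ : Allocation n m, maxLoad w ρ = 0 := fun ρ => by
      obtain ⟨i, hi⟩ := exists_maxLoad_eq (by omega) w ρ
      simp [hi, hw0]
    simp [hload]
  have hM' : (0 : ℝ) < M := by positivity
  set v : Fin m → ℝ := fun j => w j / M with hv
  -- Chosen so that `exp (-a)` cancels the union over `n` bins times the moment bound `exp (exp s -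
  -- 1)`.
  set a : ℝ := Real.log n + (Real.exp s - 1) with ha
  have hv0 : ∀ j, 0 ≤ v j := fun j => by positivity
  have hv1 : ∀ j, v j ≤ 1 := fun j => (div_le_one hM').2 (by exact_mod_cast hw j)
  have hvsum : ∑ j, v j ≤ n := by
    rw [← Finset.sum_div, div_le_iff₀ hM']
    exact_mod_cast hsum
  -- The tangent bound `x ≤ a - 1 + exp (x - a)` takes the place of Jensen's inequality or a tail
  -- estimate; the maximum is then replaced by a sum over bins.
  have hpt : ∀ ρ : Allocation n m, s * ((maxLoad w ρ : ℝ) / M) ≤ a - 1 +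
      Real.exp (-a) * ∑ i : Fin n, Real.exp (s * ∑ j, if ρ j = i then v j else 0) := by
    intro ρ
    obtain ⟨i, hi⟩ := exists_maxLoad_eq (by omega) w ρ
    have hx : (maxLoad w ρ : ℝ) / M = ∑ j, if ρ j = i then v j else 0 := by
      rw [hi, NNReal.coe_sum, Finset.sum_div]
      refine Finset.sum_congr rfl fun j _ => ?_
      split_ifs <;> simp [hv]
    have hle := Finset.single_le_sum (s := Finset.univ)
      (f := fun i : Fin n => Real.exp (s * ∑ j, if ρ j = i then v j else 0))
      (fun _ _ => (Real.exp_pos _).le) (Finset.mem_univ i)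
    have h1 := Real.add_one_le_exp (s * ((maxLoad w ρ : ℝ) / M) - a)
    have h2 : Real.exp (s * ((maxLoad w ρ : ℝ) / M) - a) ≤
        Real.exp (-a) * ∑ i : Fin n, Real.exp (s * ∑ j, if ρ j = i then v j else 0) := by
      rw [sub_eq_neg_add, Real.exp_add, hx]
      gcongr
    linarith
  have htot : s / M * ∑ ρ : Allocation n m, (maxLoad w ρ : ℝ) ≤ (n : ℝ) ^ m * a := by
    calc _ = ∑ ρ : Allocation n m, s * ((maxLoad w ρ : ℝ) / M) := by
          rw [Finset.mul_sum]
          exact Finset.sum_congr rfl fun ρ _ => by ring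
      _ ≤ ∑ ρ : Allocation n m, (a - 1 + Real.exp (-a) *
            ∑ i : Fin n, Real.exp (s * ∑ j, if ρ j = i then v j else 0)) :=
          Finset.sum_le_sum fun ρ _ => hpt ρ
      _ = (n : ℝ) ^ m * (a - 1) + Real.exp (-a) * ∑ i : Fin n, ∑ ρ : Allocation n m,
            Real.exp (s * ∑ j, if ρ j = i then v j else 0) := by
          rw [Finset.sum_add_distrib, ← Finset.mul_sum, Finset.sum_comm]
          simp
          ring
      _ ≤ (n : ℝ) ^ m * (a - 1) + Real.exp (-a) * ∑ _i : Fin n,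
            (n : ℝ) ^ m * Real.exp (Real.exp s - 1) := by
          gcongr with i
          exact sum_exp_load_le (by omega) hs.le v hv0 hv1 hvsum i
      _ = (n : ℝ) ^ m * (a - 1) + (n : ℝ) ^ m *
            (Real.exp (-a) * (Real.exp (Real.log n) * Real.exp (Real.exp s - 1))) := by
          rw [Real.exp_log hn0]
          simp
          ring
      _ = (n : ℝ) ^ m * a := by
          rw [← Real.exp_add, ← ha, ← Real.exp_add, neg_add_cancel, Real.exp_zero]
          ring
  have ha2 : a ≤ 2 * Real.log n := by rw [ha, hes]; linarith
  have h3 : s / M * ∑ ρ : Allocation n m, (maxLoad w ρ : ℝ) ≤ (n : ℝ) ^ m * (2 * Real.log n) :=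
    htot.trans (by gcongr)
  rw [div_mul_eq_mul_div, div_le_iff₀ hM', ← le_div_iff₀' hs] at h3
  exact h3.trans_eq (by ring)

/-! ### VCG probabilities and lower bounds on the optimum. -/

lemma mem_fastest {n m : ℕ} {t : Times n m} {j : Fin m} {i : Fin n} :
    i ∈ fastest t j ↔ ∀ i', t i j ≤ t i' j := by
  simp [fastest]

lemma sum_vcgProb {n m : ℕ} (hn : 0 < n) (t : Times n m) :
    ∑ σ : Allocation n m, vcgProb t σ = 1 := by
  have : Nonempty (Fin n) := ⟨⟨0, hn⟩⟩
  have h := Finset.prod_univ_sum (fun _ : Fin m => (Finset.univ : Finset (Fin n)))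
    fun j k => if k ∈ fastest t j then ((fastest t j).card : ℝ≥0)⁻¹ else 0
  rw [Fintype.piFinset_univ] at h
  refine h.symm.trans (Finset.prod_eq_one fun j _ => ?_)
  have hne : (fastest t j).Nonempty := by
    obtain ⟨i, hi⟩ := Finite.exists_min fun i => t i j
    exact ⟨i, mem_fastest.2 hi⟩
  rw [← Finset.sum_filter, Finset.filter_mem_eq_inter, Finset.univ_inter, Finset.sum_const,
    nsmul_eq_mul, mul_inv_cancel₀]
  exact_mod_cast hne.card_ne_zero

lemma mem_fastest_of_vcgProb_ne_zero {n m : ℕ} {t : Times n m} {σ : Allocation n m}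
    (h : vcgProb t σ ≠ 0) (j : Fin m) (i : Fin n) : t (σ j) j ≤ t i j := by
  have hj := Finset.prod_ne_zero_iff.1 h j (Finset.mem_univ j)
  have hmem : σ j ∈ fastest t j := by
    by_contra hc
    simp [hc] at hj
  exact mem_fastest.1 hmem i

/-- The largest of the shortest processing times is a lower bound on the optimum. -/
lemma le_opt_of_forall_le {n m : ℕ} (hn : 0 < n) (t : Times n m) (w : Fin m → ℝ≥0)
    (hw : ∀ i j, w j ≤ t i j) (j : Fin m) : w j ≤ opt t := by
  have : Nonempty (Fin n) := ⟨⟨0, hn⟩⟩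
  refine le_ciInf fun σ => (hw (σ j) j).trans ?_
  calc t (σ j) j ≤ workload t σ (σ j) := by
        unfold workload
        refine le_trans ?_ (Finset.single_le_sum (fun _ _ => bot_le) (Finset.mem_univ j))
        simp
    _ ≤ makespan t σ := Finset.le_sup (Finset.mem_univ _)

/-- The average of the shortest processing times per machine is a lower bound on the optimum. -/
lemma sum_le_mul_opt {n m : ℕ} (hn : 0 < n) (t : Times n m) (w : Fin m → ℝ≥0)
    (hw : ∀ i j, w j ≤ t i j) : ∑ j, w j ≤ n * opt t := by
  have : Nonempty (Fin n) := ⟨⟨0, hn⟩⟩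
  obtain ⟨σ, hσ⟩ := exists_eq_ciInf_of_finite (f := fun σ : Allocation n m => makespan t σ)
  have hσ' : opt t = makespan t σ := hσ.symm
  rw [hσ']
  calc ∑ j, w j ≤ ∑ j, t (σ j) j := Finset.sum_le_sum fun j _ => hw _ j
    _ = ∑ i, workload t σ i := by
        unfold workload
        rw [Finset.sum_comm]
        simp
    _ ≤ ∑ _i : Fin n, makespan t σ :=
        Finset.sum_le_sum fun i _ => Finset.le_sup (f := workload t σ) (Finset.mem_univ i)
    _ = n * makespan t σ := by simp

/-! ### Averaging over relabellings. -/

/-- Relabelling the machines separately for each task by cyclic shifts. -/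
def shift {n m : ℕ} [NeZero n] (π : Fin m → Fin n) (t : Times n m) : Times n m :=
  fun i j => t (i + π j) j

lemma vcgProb_shift {n m : ℕ} [NeZero n] (π : Fin m → Fin n) (t : Times n m)
    (τ : Allocation n m) : vcgProb (shift π t) (τ - π) = vcgProb t τ := by
  have hmem : ∀ j k, k - π j ∈ fastest (shift π t) j ↔ k ∈ fastest t j := by
    intro j k
    simp only [mem_fastest, shift, sub_add_cancel]
    exact ⟨fun h i => by simpa using h (i - π j), fun h i => h _⟩
  have hcard : ∀ j, (fastest (shift π t) j).card = (fastest t j).card := by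
    intro j
    refine (Finset.card_equiv (Equiv.subRight (π j)) fun k => ?_).symm
    exact (hmem j k).symm
  unfold vcgProb
  refine Finset.prod_congr rfl fun j _ => ?_
  simp only [Pi.sub_apply, hmem, hcard]

lemma makespan_shift {n m : ℕ} [NeZero n] (π : Fin m → Fin n) (t : Times n m)
    (τ : Allocation n m) :
    makespan (shift π t) (τ - π) = maxLoad (fun j => t (τ j) j) (τ - π) := by
  rw [makespan_eq_maxLoad]
  simp [shift]

/-- For fixed `τ`, the allocation `τ - π` runs once through all allocations as `π` varies, while its
probability and the weights `t (τ j) j` stay fixed. -/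
lemma sum_vcg_shift {n m : ℕ} [NeZero n] (t : Times n m) :
    ∑ π : Fin m → Fin n, vcg (shift π t) =
      ∑ τ : Allocation n m, vcgProb t τ *
        ∑ ρ : Allocation n m, maxLoad (fun j => t (τ j) j) ρ := by
  have h : ∀ π : Fin m → Fin n, vcg (shift π t) = ∑ τ : Allocation n m, vcgProb t τ *
      maxLoad (fun j => t (τ j) j) (τ - π) := by
    intro π
    unfold vcg
    rw [← Equiv.sum_comp (Equiv.subRight π)]
    refine Finset.sum_congr rfl fun τ _ => ?_
    rw [Equiv.subRight_apply, vcgProb_shift, makespan_shift]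
  simp_rw [h]
  rw [Finset.sum_comm]
  refine Finset.sum_congr rfl fun τ _ => ?_
  rw [← Finset.mul_sum, ← Equiv.sum_comp (Equiv.subLeft τ)]
  simp

/-- Averaged over all cyclic relabellings of the machines, VCG is competitive on every input. -/
lemma sum_vcg_shift_le {n m : ℕ} [NeZero n] (hn : 3 ≤ n) (t : Times n m) :
    ∑ π : Fin m → Fin n, (vcg (shift π t) : ℝ) ≤
      (n : ℝ) ^ m * (2 * (Real.log n / Real.log (Real.log n)) * opt t) := by
  have hone : ∑ τ : Allocation n m, (vcgProb t τ : ℝ) = 1 := by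
    exact_mod_cast sum_vcgProb (by omega) t
  rw [← NNReal.coe_sum, sum_vcg_shift]
  push_cast
  rw [← one_mul ((n : ℝ) ^ m * _), ← hone, Finset.sum_mul]
  refine Finset.sum_le_sum fun τ _ => ?_
  -- Only allocations of positive probability are known to use minimal times.
  by_cases hτ : vcgProb t τ = 0
  · simp [hτ]
  have hw : ∀ i j, t (τ j) j ≤ t i j := fun i j => mem_fastest_of_vcgProb_ne_zero hτ j i
  gcongr
  exact sum_maxLoad_le hn _ _ (le_opt_of_forall_le (by omega) t _ hw)
    (sum_le_mul_opt (by omega) t _ hw)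

/-! ### Measurability and invariance in law. -/

lemma measurable_vcg {n m : ℕ} :
    Measurable fun x : Fin n × Fin m → ℝ≥0 => vcg fun i j => x (i, j) := by
  have hset : ∀ (i : Fin n) (j : Fin m), MeasurableSet
      {x : Fin n × Fin m → ℝ≥0 | ∀ i' : Fin n, x (i, j) ≤ x (i', j)} := fun i j => by
    rw [Set.ofPred_forall]
    exact MeasurableSet.iInter fun i' => measurableSet_le (by fun_prop) (by fun_prop)
  unfold vcg vcgProb makespan
  simp only [fastest, Finset.mem_filter, Finset.mem_univ, true_and, Finset.card_filter]
  push_cast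
  refine Finset.measurable_sum _ fun σ _ => Measurable.mul ?_ ?_
  · refine Finset.measurable_prod _ fun j _ => Measurable.ite (hset _ _) ?_ measurable_const
    exact (Finset.measurable_sum _ fun i _ =>
      Measurable.ite (hset _ _) measurable_const measurable_const).inv
  · have hload : ∀ i, Measurable fun x : Fin n × Fin m → ℝ≥0 =>
        workload (fun i j => x (i, j)) σ i := fun i => by
      unfold workload
      refine Finset.measurable_sum _ fun j _ => ?_
      split_ifs <;> fun_prop
    have hsup := Finset.sup_induction (s := Finset.univ)
      (f := fun i (x : Fin n × Fin m → ℝ≥0) => workload (fun i j => x (i, j)) σ i)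
      (p := Measurable) measurable_const (fun _ hf _ hg => hf.sup hg) fun i _ => hload i
    convert hsup using 2 with x
    rw [Finset.sup_apply]

/-- Since the machines are identically distributed for each task and all times are independent,
relabelling the machines separately for each task does not change the expected makespan. -/
lemma lintegral_vcg_shift {n m : ℕ} [NeZero n] {Ω : Type*} [MeasurableSpace Ω] {P : Measure Ω}
    [IsProbabilityMeasure P] {D : Fin m → Measure ℝ≥0} {t : Fin n → Fin m → Ω → ℝ≥0}
    (hlaw : ∀ i j, HasLaw (t i j) (D j) P)
    (hind : iIndepFun (fun p : Fin n × Fin m => t p.1 p.2) P) (π : Fin m → Fin n) :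
    ∫⁻ ω, (vcg (shift π fun i j => t i j ω) : ℝ≥0∞) ∂P =
      ∫⁻ ω, (vcg (fun i j => t i j ω) : ℝ≥0∞) ∂P := by
  have hmeas : ∀ p : Fin n × Fin m, AEMeasurable (t p.1 p.2) P := fun p =>
    (hlaw p.1 p.2).aemeasurable
  -- Injectivity keeps the relabelled family independent; as `D` depends on the task only, both
  -- joint laws are the same product measure.
  have hinj : Function.Injective fun p : Fin n × Fin m => (p.1 + π p.2, p.2) := by
    rintro ⟨a, b⟩ ⟨c, d⟩ h
    obtain ⟨h1, rfl⟩ := Prod.mk.inj h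
    simpa using h1
  have hmap := (iIndepFun_iff_map_fun_eq_pi_map hmeas).1 hind
  have hmap' := (iIndepFun_iff_map_fun_eq_pi_map fun p : Fin n × Fin m =>
    hmeas (p.1 + π p.2, p.2)).1 (hind.precomp hinj)
  simp only [(hlaw _ _).map_eq] at hmap hmap'
  have hF : Measurable fun x : Fin n × Fin m → ℝ≥0 =>
      ((vcg fun i j => x (i, j) : ℝ≥0) : ℝ≥0∞) := measurable_vcg.coe_nnreal_ennreal
  have h1 := lintegral_map' (μ := P) hF.aemeasurable (aemeasurable_pi_lambda _ hmeas)
  have h2 := lintegral_map' (μ := P) hF.aemeasurable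
    (aemeasurable_pi_lambda _ fun p : Fin n × Fin m => hmeas (p.1 + π p.2, p.2))
  exact h2.symm.trans ((by rw [hmap, hmap'] : _ = _).trans h1)

lemma aemeasurable_vcg_shift {n m : ℕ} [NeZero n] {Ω : Type*} [MeasurableSpace Ω] {P : Measure Ω}
    {t : Fin n → Fin m → Ω → ℝ≥0} (ht : ∀ i j, AEMeasurable (t i j) P) (π : Fin m → Fin n) :
    AEMeasurable (fun ω => (vcg (shift π fun i j => t i j ω) : ℝ≥0∞)) P :=
  measurable_vcg.coe_nnreal_ennreal.comp_aemeasurable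
    (f := fun ω (p : Fin n × Fin m) => t (p.1 + π p.2) p.2 ω)
    (aemeasurable_pi_lambda _ fun _ => ht _ _)

end Scheduling

theorem theorem1 :
    ∃ C : ℝ, 0 < C ∧
      ∀ (n m : ℕ), 3 ≤ n →
      ∀ {Ω : Type*} [MeasurableSpace Ω] (P : MeasureTheory.Measure Ω)
        [MeasureTheory.IsProbabilityMeasure P]
        (D : Fin m → MeasureTheory.Measure ℝ≥0)
        (t : Fin n → Fin m → Ω → ℝ≥0),
        (∀ i j, ProbabilityTheory.HasLaw (t i j) (D j) P) →
        ProbabilityTheory.iIndepFun (fun p : Fin n × Fin m => t p.1 p.2) P →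
        ∫⁻ ω, (Scheduling.vcg (fun i j => t i j ω) : ℝ≥0∞) ∂P ≤
          ENNReal.ofReal (C * (Real.log n / Real.log (Real.log n))) *
            ∫⁻ ω, (Scheduling.opt (fun i j => t i j ω) : ℝ≥0∞) ∂P := by
  refine ⟨2, two_pos, fun n m hn Ω _ P _ D t hlaw hind => ?_⟩
  have : NeZero n := ⟨by omega⟩
  set K : ℝ := 2 * (Real.log n / Real.log (Real.log n)) with hK
  have hN0 : (n : ℝ≥0∞) ^ m ≠ 0 := pow_ne_zero _ (by exact_mod_cast NeZero.ne n)
  have hNt : (n : ℝ≥0∞) ^ m ≠ ⊤ := ENNReal.pow_ne_top (ENNReal.natCast_ne_top n)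
  have hpt : ∀ ω, ∑ π : Fin m → Fin n,
      (Scheduling.vcg (Scheduling.shift π fun i j => t i j ω) : ℝ≥0∞) ≤
        (n : ℝ≥0∞) ^ m * ENNReal.ofReal K * (Scheduling.opt (fun i j => t i j ω) : ℝ≥0∞) := by
    intro ω
    have h := ENNReal.ofReal_le_ofReal (Scheduling.sum_vcg_shift_le hn fun i j => t i j ω)
    rw [← hK, ← NNReal.coe_sum, ENNReal.ofReal_coe_nnreal,
      ENNReal.ofReal_mul (by positivity), ENNReal.ofReal_mul' (NNReal.coe_nonneg _),
      ENNReal.ofReal_coe_nnreal, ENNReal.ofReal_pow (by positivity), ENNReal.ofReal_natCast,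
      ← mul_assoc] at h
    exact_mod_cast h
  have hsum : (n : ℝ≥0∞) ^ m * ∫⁻ ω, (Scheduling.vcg (fun i j => t i j ω) : ℝ≥0∞) ∂P ≤
      (n : ℝ≥0∞) ^ m * (ENNReal.ofReal K *
        ∫⁻ ω, (Scheduling.opt (fun i j => t i j ω) : ℝ≥0∞) ∂P) := by
    calc _ = ∑ π : Fin m → Fin n,
          ∫⁻ ω, (Scheduling.vcg (Scheduling.shift π fun i j => t i j ω) : ℝ≥0∞) ∂P := by
          simp [Scheduling.lintegral_vcg_shift hlaw hind]
      _ = ∫⁻ ω, ∑ π : Fin m → Fin n,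
          (Scheduling.vcg (Scheduling.shift π fun i j => t i j ω) : ℝ≥0∞) ∂P :=
          (MeasureTheory.lintegral_finsetSum' _ fun π _ =>
            Scheduling.aemeasurable_vcg_shift (fun i j => (hlaw i j).aemeasurable) π).symm
      _ ≤ _ := MeasureTheory.lintegral_mono hpt
      _ = _ := by
          rw [MeasureTheory.lintegral_const_mul' _ _ (ENNReal.mul_ne_top hNt ENNReal.ofReal_ne_top),
            mul_assoc]
  exact (ENNReal.mul_le_mul_iff_right hN0 hNt).1 hsum
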